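/- Let $\mathfrak X$ be a complex vector space. A \emph{form} on $\mathfrak X$ is a map $\mathfrak t:\mathfrak X\times\mathfrak X\to\mathbb C$, linear in the first and antilinear in the second variable, with $\mathfrak t[x]:=\mathfrak t(x,x)\ge 0$ for all $x$; write $\mathfrak s\le\mathfrak t$ if $\mathfrak s[x]\le\mathfrak t[x]$ for all $x$, and $[\mathfrak 0,\mathfrak t]$ for the set of forms $\mathfrak w$ with $\mathfrak 0\le\mathfrak w\le\mathfrak t$. The parallel sum $\mathfrak t:\mathfrak w$ is the form with $(\mathfrak t:\mathfrak w)[x]=\inf_{y\in\mathfrak X}(\mathfrak t[x-y]+\mathfrak w[y])$, and the generalized short of $\mathfrak t$ with respect to $\mathfrak w$ is the form $\mathbf D_{\mathfrak w}\mathfrak t=\sup_{n}\,\mathfrak t:(n\mathfrak w)$ (pointwise supremum of quadratic forms). Analogously, for bounded positive operators $A,B$ on a complex Hilbert space, $A:B$ is the positive operator with $\langle (A:B)x,x\rangle=\inf_{y}(\langle A(x-y),x-y\rangle+\langle By,y\rangle)$, and $[A]B=\sup_n\, B:(nA)$. Two forms $\mathfrak u,\mathfrak v$ are \emph{singular} if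 $\mathfrak 0$ is the only form $\mathfrak s$ with $\mathfrak s\le\mathfrak u$ and $\mathfrak s\le\mathfrak v$; a form $\mathfrak w\le\mathfrak t$ is a \emph{disjoint part} of $\mathfrak t$ if $\mathfrak w$ and $\mathfrak t-\mathfrak w$ are singular. Let $\mathfrak t$ be a form on $\mathfrak X$, let $\ker\mathfrak t=\{x:\mathfrak t[x]=0\}$, and let $\mathcal H_{\mathfrak t}$ be the Hilbert space completion of $\mathfrak X/\ker\mathfrak t$ with the inner product $\langle x+\ker\mathfrak t,y+\ker\mathfrak t\rangle_{\mathfrak t}=\mathfrak t(x,y)$. Let $[0,I]$ be the set of bounded operators $A$ on $\mathcal H_{\mathfrak t}$ with $0\le A\le I$. (1) There is an order isomorphism (a bijection preserving the order in both directions) $\Phi:[\mathfrak 0,\mathfrak t]\to[0,I]$ such that $\langle\Phi(\mathfrak w)(x+\ker\mathfrak t),y+\ker\mathfrak t\rangle_{\mathfrak t}=\mathfrak w(x,y)$ for all $\mathfrak w\in[\mathfrak 0,\mathfrak t]$ and $x,y\in\mathfrak X$, and such that for all $\mathfrak u,\mathfrak v\in[\mathfrak 0,\mathfrak t]$: (a)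 $\alpha\mathfrak u+\beta\mathfrak v\in[\mathfrak 0,\mathfrak t]$ and $\Phi(\alpha\mathfrak u+\beta\mathfrak v)=\alpha\Phi(\mathfrak u)+\beta\Phi(\mathfrak v)$ whenever $\alpha,\beta\ge 0$ and $\alpha+\beta=1$; (b) $\mathfrak u:\mathfrak v\in[\mathfrak 0,\mathfrak t]$ and $\Phi(\mathfrak u:\mathfrak v)=\Phi(\mathfrak u):\Phi(\mathfrak v)$; (c) $\mathbf D_{\mathfrak u}\mathfrak v\in[\mathfrak 0,\mathfrak t]$ and $\Phi(\mathbf D_{\mathfrak u}\mathfrak v)=[\Phi(\mathfrak u)]\Phi(\mathfrak v)$. (2) For every form $\mathfrak w\in[\mathfrak 0,\mathfrak t]$ the following are equivalent: (i) $\mathfrak w$ is a $\mathfrak t$-quasi-unit, i.e. $\mathbf D_{\mathfrak w}\mathfrak t=\mathfrak w$; (ii) $\mathfrak w$ is an extreme point of $[\mathfrak 0,\mathfrak t]$; (iii) $\mathfrak w$ is a disjoint part of $\mathfrak t$. (3) For any two forms $\mathfrak u,\mathfrak v$ on $\mathfrak X$, the infimum of $\mathfrak u$ and $\mathfrak v$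 in the partially ordered set of all forms on $\mathfrak X$ exists if and only if $\mathbf D_{\mathfrak u}\mathfrak v\le\mathbf D_{\mathfrak v}\mathfrak u$ or $\mathbf D_{\mathfrak v}\mathfrak u\le\mathbf D_{\mathfrak u}\mathfrak v$. -/

import Mathlib

open scoped NNReal InnerProductSpace

noncomputable section

/-- A nonnegative sesquilinear form on the complex vector space `X`: linear in the first argument,
antilinear in the second argument, with `t(x,x)` real and nonnegative for every `x`. -/
structure NonnegForm (X : Type*) [AddCommGroup X] [Module ℂ X] where
  /-- the underlying sesquilinear map -/
  toSesq : X →ₗ[ℂ] X →ₗ⋆[ℂ] ℂ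
  re_nonneg' : ∀ x, 0 ≤ (toSesq x x).re
  im_eq_zero' : ∀ x, (toSesq x x).im = 0

namespace NonnegForm

variable {X : Type*} [AddCommGroup X] [Module ℂ X]

instance : CoeFun (NonnegForm X) (fun _ => X → X →ₗ⋆[ℂ] ℂ) := ⟨fun t => t.toSesq⟩

/-- The quadratic form `t[x] = t(x,x)`. -/
def quad (t : NonnegForm X) (x : X) : ℝ := (t x x).re

theorem quad_nonneg (t : NonnegForm X) (x : X) : 0 ≤ t.quad x := t.re_nonneg' x

theorem apply_self (t : NonnegForm X) (x : X) : t x x = (t.quad x : ℂ) :=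
  Complex.ext rfl (by simpa using t.im_eq_zero' x)

theorem toSesq_injective : Function.Injective (toSesq (X := X)) := by
  rintro ⟨a, _, _⟩ ⟨b, _, _⟩ h
  cases h
  rfl

/-- Polarization. -/
theorem polarization (t : NonnegForm X) (x y : X) :
    t x y = (1 / 4 : ℂ) * ((t.quad (x + y) : ℂ) - (t.quad (x - y) : ℂ)
      + Complex.I * (t.quad (x + Complex.I • y) : ℂ)
      - Complex.I * (t.quad (x - Complex.I • y) : ℂ)) := by
  simp only [← apply_self, map_add, map_sub, map_smul, LinearMap.add_apply, LinearMap.sub_apply,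
    LinearMap.smul_apply, LinearMap.map_smulₛₗ, Complex.conj_I, smul_eq_mul]
  linear_combination (1 / 2 : ℂ) * (t x y - t y x) * Complex.I_mul_I

theorem ext_quad {s t : NonnegForm X} (h : ∀ x, s.quad x = t.quad x) : s = t := by
  apply toSesq_injective
  ext x y
  change s x y = t x y
  simp only [polarization, h]

theorem conj_apply (t : NonnegForm X) (x y : X) : starRingEnd ℂ (t x y) = t y x := by
  have h1 := t.im_eq_zero' (x + y)
  have h2 := t.im_eq_zero' (x + Complex.I • y)
  have hx := t.im_eq_zero' x
  have hy := t.im_eq_zero' y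
  simp only [map_add, map_smul, LinearMap.add_apply, LinearMap.smul_apply, LinearMap.map_smulₛₗ,
    Complex.conj_I, smul_eq_mul, Complex.add_im, Complex.add_re, Complex.mul_im, Complex.mul_re,
    Complex.I_re, Complex.I_im, Complex.neg_re, Complex.neg_im, hx, hy] at h1 h2
  apply Complex.ext
  · simp only [Complex.conj_re]
    linarith
  · simp only [Complex.conj_im]
    linarith

/-! ### The ordered cone of forms -/

instance : Zero (NonnegForm X) := ⟨⟨0, by simp, by simp⟩⟩

instance : Add (NonnegForm X) :=
  ⟨fun s t => ⟨s.toSesq + t.toSesq,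
    fun x => by simpa using add_nonneg (s.re_nonneg' x) (t.re_nonneg' x),
    fun x => by simp [s.im_eq_zero' x, t.im_eq_zero' x]⟩⟩

instance : SMul ℝ≥0 (NonnegForm X) :=
  ⟨fun c t => ⟨c • t.toSesq,
    fun x => by simpa [NNReal.smul_def] using mul_nonneg c.2 (t.re_nonneg' x),
    fun x => by simp [NNReal.smul_def, t.im_eq_zero' x]⟩⟩

instance : SMul ℕ (NonnegForm X) :=
  ⟨fun n t => ⟨n • t.toSesq,
    fun x => by simpa using mul_nonneg n.cast_nonneg (t.re_nonneg' x),
    fun x => by simp [t.im_eq_zero' x]⟩⟩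

instance : AddCommMonoid (NonnegForm X) :=
  toSesq_injective.addCommMonoid toSesq rfl (fun _ _ => rfl) (fun _ _ => rfl)

instance : Module ℝ≥0 (NonnegForm X) :=
  toSesq_injective.module ℝ≥0 ⟨⟨toSesq, rfl⟩, fun _ _ => rfl⟩ (fun _ _ => rfl)

/-- `s ≤ t` iff `s[x] ≤ t[x]` for all `x`. -/
instance : PartialOrder (NonnegForm X) where
  le s t := ∀ x, s.quad x ≤ t.quad x
  le_refl _ _ := le_rfl
  le_trans _ _ _ h₁ h₂ x := (h₁ x).trans (h₂ x)
  le_antisymm _ _ h₁ h₂ := ext_quad fun x => le_antisymm (h₁ x) (h₂ x)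

theorem le_def {s t : NonnegForm X} : s ≤ t ↔ ∀ x, s.quad x ≤ t.quad x := Iff.rfl

@[simp] theorem quad_zero (x : X) : (0 : NonnegForm X).quad x = 0 := rfl

@[simp] theorem quad_add (s t : NonnegForm X) (x : X) :
    (s + t).quad x = s.quad x + t.quad x := rfl

@[simp] theorem quad_nsmul (n : ℕ) (t : NonnegForm X) (x : X) :
    (n • t).quad x = n * t.quad x := by
  change ((n • t.toSesq) x x).re = _
  simp [quad]

/-- The difference `t - w` of two forms with `w ≤ t`. -/
def sub (t w : NonnegForm X) (h : w ≤ t) : NonnegForm X where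
  toSesq := t.toSesq - w.toSesq
  re_nonneg' x := by simpa [quad] using h x
  im_eq_zero' x := by simp [t.im_eq_zero' x, w.im_eq_zero' x]

/-- Two forms are singular if the zero form is the only form below both of them. -/
def Singular (s t : NonnegForm X) : Prop := ∀ r : NonnegForm X, r ≤ s → r ≤ t → r = 0

/-- `w` is a disjoint part of `t`: `w ≤ t`, and `w` and `t - w` are singular. -/
def IsDisjointPart (w t : NonnegForm X) : Prop := ∃ h : w ≤ t, Singular w (t.sub w h)

/-! ### The Hilbert space of a form -/

set_option linter.unusedVariables false in
/-- The space `X`, regarded as a semi-inner product space with the semi-inner product `t`. -/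
@[nolint unusedArguments]
def Pre (t : NonnegForm X) : Type _ := X

instance (t : NonnegForm X) : AddCommGroup t.Pre := inferInstanceAs (AddCommGroup X)
instance (t : NonnegForm X) : Module ℂ t.Pre := inferInstanceAs (Module ℂ X)

/-- The identity map from `X` to `t.Pre`. -/
def toPre (t : NonnegForm X) : X ≃ₗ[ℂ] t.Pre := LinearEquiv.refl ℂ X

/-- The semi-inner product given by `t`. Mathlib's inner products are antilinear in the first
argument, so that the arguments are swapped. -/
abbrev preCore (t : NonnegForm X) : PreInnerProductSpace.Core ℂ t.Pre where
  inner x y := t (t.toPre.symm y) (t.toPre.symm x)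
  conj_inner_symm _ _ := t.conj_apply _ _
  re_inner_nonneg _ := t.quad_nonneg _
  add_left _ _ _ := by simp
  smul_left _ _ _ := by simp

instance (t : NonnegForm X) : SeminormedAddCommGroup t.Pre :=
  InnerProductSpace.Core.toSeminormedAddCommGroup (c := t.preCore)

instance (t : NonnegForm X) : InnerProductSpace ℂ t.Pre :=
  InnerProductSpace.ofCore t.preCore

/-- The Hilbert space `H_t`: the completion of the quotient of `X` by `ker t = {x | t[x] = 0}`. -/
abbrev H (t : NonnegForm X) : Type _ := UniformSpace.Completion (SeparationQuotient t.Pre)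

/-- The canonical map `x ↦ x + ker t` from `X` to `H_t`. -/
def toH (t : NonnegForm X) : X →ₗ[ℂ] t.H where
  toFun x := ((SeparationQuotient.mk (t.toPre x) : SeparationQuotient t.Pre) : t.H)
  map_add' x y := by
    rw [map_add, SeparationQuotient.mk_add, UniformSpace.Completion.coe_add]
  map_smul' c x := by
    rw [map_smul, SeparationQuotient.mk_smul, UniformSpace.Completion.coe_smul, RingHom.id_apply]

theorem inner_toH (t : NonnegForm X) (x y : X) : ⟪t.toH x, t.toH y⟫_ℂ = t y x := by
  change ⟪((SeparationQuotient.mk (t.toPre x) : SeparationQuotient t.Pre) : t.H),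
    ((SeparationQuotient.mk (t.toPre y) : SeparationQuotient t.Pre) : t.H)⟫_ℂ = _
  rw [UniformSpace.Completion.inner_coe, SeparationQuotient.inner_mk_mk]
  rfl

theorem norm_toH_sq (t : NonnegForm X) (x : X) : ‖t.toH x‖ ^ 2 = t.quad x := by
  rw [@norm_sq_eq_re_inner ℂ, inner_toH]
  rfl

theorem norm_apply_sq_le (t : NonnegForm X) (x y : X) :
    ‖t x y‖ ^ 2 ≤ t.quad x * t.quad y := by
  rw [← inner_toH, ← norm_toH_sq, ← norm_toH_sq, ← mul_pow, mul_comm ‖t.toH x‖]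
  exact pow_le_pow_left₀ (norm_nonneg _) (norm_inner_le_norm (𝕜 := ℂ) (t.toH y) (t.toH x)) 2

/-! ### Parallel sum -/

/-- The form `⟨f x, f y⟩` induced by a linear map `f` into an inner product space. -/
def ofMap {E : Type*} [NormedAddCommGroup E] [InnerProductSpace ℂ E] (f : X →ₗ[ℂ] E) :
    NonnegForm X where
  toSesq := LinearMap.mk₂'ₛₗ (RingHom.id ℂ) (starRingEnd ℂ) (fun x y => ⟪f y, f x⟫_ℂ)
    (fun x y z => by simp)
    (fun c x y => by simp)
    (fun x y z => by simp)
    (fun c x y => by simp [mul_comm])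
  re_nonneg' x := by simpa using @inner_self_nonneg ℂ _ _ _ _ (f x)
  im_eq_zero' x := by simpa using @inner_self_im ℂ _ _ _ _ (f x)

theorem quad_ofMap {E : Type*} [NormedAddCommGroup E] [InnerProductSpace ℂ E] (f : X →ₗ[ℂ] E)
    (x : X) : (ofMap f).quad x = ‖f x‖ ^ 2 := by
  rw [@norm_sq_eq_re_inner ℂ]
  rfl

/-- The squared distance of `U x` from the range of `V` is a nonnegative quadratic form. -/
theorem exists_quad_eq_iInf {E : Type*} [NormedAddCommGroup E] [InnerProductSpace ℂ E]
    [CompleteSpace E] (U V : X →ₗ[ℂ] E) :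
    ∃ s : NonnegForm X, ∀ x, s.quad x = ⨅ y, ‖U x - V y‖ ^ 2 := by
  let K : Submodule ℂ E := (LinearMap.range V).topologicalClosure
  have : CompleteSpace K := (LinearMap.range V).isClosed_topologicalClosure.completeSpace_coe
  refine ⟨ofMap ((Kᗮ.starProjection : E →ₗ[ℂ] E) ∘ₗ U), fun x => ?_⟩
  rw [quad_ofMap]
  have key : ∀ e ∈ K, ‖Kᗮ.starProjection (U x)‖ ^ 2 + ‖K.starProjection (U x) - e‖ ^ 2
      = ‖U x - e‖ ^ 2 := by
    intro e he
    have h1 : U x - e = Kᗮ.starProjection (U x) + (K.starProjection (U x) - e) := by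
      rw [Submodule.starProjection_orthogonal_val]
      abel
    rw [h1, sq, sq, sq, norm_add_sq_eq_norm_sq_add_norm_sq_of_inner_eq_zero (𝕜 := ℂ)]
    apply Submodule.inner_left_of_mem_orthogonal (K := K)
    · exact K.sub_mem (Submodule.starProjection_apply_mem _ _) he
    · exact Submodule.starProjection_apply_mem _ _
  have hV : ∀ y, V y ∈ K := fun y =>
    (LinearMap.range V).le_topologicalClosure (LinearMap.mem_range_self V y)
  have hbdd : BddBelow (Set.range fun y => ‖U x - V y‖ ^ 2) :=
    ⟨0, by rintro _ ⟨y, rfl⟩; positivity⟩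
  apply le_antisymm
  · refine le_ciInf fun y => ?_
    have := key (V y) (hV y)
    change ‖Kᗮ.starProjection (U x)‖ ^ 2 ≤ _
    nlinarith [sq_nonneg ‖K.starProjection (U x) - V y‖]
  · change _ ≤ ‖Kᗮ.starProjection (U x)‖ ^ 2
    refine le_of_forall_pos_le_add fun ε hε => ?_
    have hmem : K.starProjection (U x) ∈ closure (Set.range V) := by
      have := Submodule.starProjection_apply_mem K (U x)
      rwa [← SetLike.mem_coe, Submodule.topologicalClosure_coe, LinearMap.coe_range] at this
    obtain ⟨_, ⟨y, rfl⟩, hy⟩ := Metric.mem_closure_iff.1 hmem (Real.sqrt ε) (Real.sqrt_pos.2 hε)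
    refine (ciInf_le hbdd y).trans ?_
    rw [← key (V y) (hV y)]
    rw [dist_eq_norm] at hy
    have : ‖K.starProjection (U x) - V y‖ ^ 2 ≤ ε := by
      rw [← Real.sq_sqrt hε.le]
      exact pow_le_pow_left₀ (norm_nonneg _) hy.le 2
    linarith

theorem exists_parallelSum (t w : NonnegForm X) :
    ∃ s : NonnegForm X, ∀ x, s.quad x = ⨅ y, (t.quad (x - y) + w.quad y) := by
  let e := (WithLp.linearEquiv 2 ℂ (t.H × w.H)).symm
  obtain ⟨s, hs⟩ := exists_quad_eq_iInf (e.toLinearMap ∘ₗ (t.toH.prod (0 : X →ₗ[ℂ] w.H)))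
    (e.toLinearMap ∘ₗ (t.toH.prod (-w.toH)))
  refine ⟨s, fun x => ?_⟩
  rw [hs]
  congr 1
  funext y
  rw [WithLp.prod_norm_sq_eq_of_L2]
  change ‖t.toH x - t.toH y‖ ^ 2 + ‖0 - -w.toH y‖ ^ 2 = _
  rw [← map_sub, zero_sub, neg_neg, norm_toH_sq, norm_toH_sq]

/-- The parallel sum `t : w`, the form with `(t : w)[x] = inf_y (t[x - y] + w[y])`. -/
def parallelSum (t w : NonnegForm X) : NonnegForm X := (exists_parallelSum t w).choose

theorem quad_parallelSum (t w : NonnegForm X) (x : X) :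
    (parallelSum t w).quad x = ⨅ y, (t.quad (x - y) + w.quad y) :=
  (exists_parallelSum t w).choose_spec x

theorem bddBelow_parallelSum (t w : NonnegForm X) (x : X) :
    BddBelow (Set.range fun y => t.quad (x - y) + w.quad y) :=
  ⟨0, by rintro _ ⟨y, rfl⟩; exact add_nonneg (t.quad_nonneg _) (w.quad_nonneg _)⟩

theorem parallelSum_le_left (t w : NonnegForm X) : parallelSum t w ≤ t := fun x => by
  rw [quad_parallelSum]
  refine (ciInf_le (bddBelow_parallelSum t w x) 0).trans ?_
  simp [quad]

theorem parallelSum_mono_right (t : NonnegForm X) {v w : NonnegForm X} (h : v ≤ w) :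
    parallelSum t v ≤ parallelSum t w := fun x => by
  rw [quad_parallelSum, quad_parallelSum]
  exact ciInf_mono (bddBelow_parallelSum t v x) fun y => by simpa using h y

/-! ### Generalized short -/

/-- The pointwise supremum of a bounded increasing sequence of forms is a form. -/
theorem exists_quad_eq_iSup (f : ℕ → NonnegForm X) (hf : Monotone f) (b : NonnegForm X)
    (hb : ∀ n, f n ≤ b) : ∃ s : NonnegForm X, ∀ x, s.quad x = ⨆ n, (f n).quad x := by
  have hq : ∀ x, Filter.Tendsto (fun n => (f n).quad x) Filter.atTop
      (nhds (⨆ n, (f n).quad x)) := fun x =>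
    tendsto_atTop_ciSup (fun m n hmn => hf hmn x) ⟨b.quad x, by rintro _ ⟨n, rfl⟩; exact hb n x⟩
  have hlim : ∀ x y, ∃ l, Filter.Tendsto (fun n => f n x y) Filter.atTop (nhds l) := by
    intro x y
    have hc : ∀ z, Filter.Tendsto (fun n => ((f n).quad z : ℂ)) Filter.atTop
        (nhds ((⨆ n, (f n).quad z : ℝ) : ℂ)) := fun z =>
      (Complex.continuous_ofReal.tendsto _).comp (hq z)
    simp only [polarization]
    exact ⟨_, (((hc _).sub (hc _)).add ((hc _).const_mul _)
      |>.sub ((hc _).const_mul _)).const_mul _⟩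
  choose L hL using hlim
  have hLq : ∀ x, L x x = ((⨆ n, (f n).quad x : ℝ) : ℂ) := by
    intro x
    refine tendsto_nhds_unique (hL x x) ?_
    simp only [apply_self]
    exact (Complex.continuous_ofReal.tendsto _).comp (hq x)
  refine ⟨⟨LinearMap.mk₂'ₛₗ (RingHom.id ℂ) (starRingEnd ℂ) L ?_ ?_ ?_ ?_, ?_, ?_⟩, ?_⟩
  · intro x y z
    refine tendsto_nhds_unique (hL _ _) ?_
    simpa using (hL x z).add (hL y z)
  · intro c x z
    refine tendsto_nhds_unique (hL _ _) ?_
    simpa using (hL x z).const_mul c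
  · intro x y z
    refine tendsto_nhds_unique (hL _ _) ?_
    simpa using (hL x y).add (hL x z)
  · intro c x z
    refine tendsto_nhds_unique (hL _ _) ?_
    simpa using (hL x z).const_mul (starRingEnd ℂ c)
  · intro x
    simp only [LinearMap.mk₂'ₛₗ_apply, hLq, Complex.ofReal_re]
    exact Real.iSup_nonneg fun n => (f n).quad_nonneg x
  · intro x
    simp only [LinearMap.mk₂'ₛₗ_apply, hLq, Complex.ofReal_im]
  · intro x
    simp only [quad, LinearMap.mk₂'ₛₗ_apply, hLq, Complex.ofReal_re]

theorem nsmul_le_nsmul_of_le (w : NonnegForm X) {m n : ℕ} (h : m ≤ n) : m • w ≤ n • w :=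
  fun x => by
    rw [quad_nsmul, quad_nsmul]
    exact mul_le_mul_of_nonneg_right (by exact_mod_cast h) (w.quad_nonneg x)

theorem exists_short (w t : NonnegForm X) :
    ∃ s : NonnegForm X, ∀ x, s.quad x = ⨆ n : ℕ, (parallelSum t (n • w)).quad x :=
  exists_quad_eq_iSup _ (fun _ _ h => parallelSum_mono_right t (nsmul_le_nsmul_of_le w h)) t
    (fun _ => parallelSum_le_left _ _)

/-- The generalized short `D_w t = sup_n (t : n w)`. -/
def short (w t : NonnegForm X) : NonnegForm X := (exists_short w t).choose

theorem quad_short (w t : NonnegForm X) (x : X) :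
    (short w t).quad x = ⨆ n : ℕ, (parallelSum t (n • w)).quad x :=
  (exists_short w t).choose_spec x

/-- `w` is a `t`-quasi-unit: `D_w t = w`. -/
def IsQuasiUnit (w t : NonnegForm X) : Prop := short w t = w

end NonnegForm

/-! ### Positive operators on a Hilbert space -/

namespace PosOp

variable {E : Type*} [NormedAddCommGroup E] [InnerProductSpace ℂ E]

/-- The form `(x, y) ↦ ⟨A x, y⟩` of a positive operator `A`. -/
def toForm (A : E →L[ℂ] E) (hA : 0 ≤ A) : NonnegForm E where
  toSesq := LinearMap.mk₂'ₛₗ (RingHom.id ℂ) (starRingEnd ℂ) (fun x y => ⟪y, A x⟫_ℂ)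
    (fun x y z => by simp)
    (fun c x y => by simp)
    (fun x y z => by simp)
    (fun c x y => by simp [mul_comm])
  re_nonneg' x := by
    simpa using ((ContinuousLinearMap.nonneg_iff_isPositive A).1 hA).re_inner_nonneg_right x
  im_eq_zero' x := by
    have h := ((ContinuousLinearMap.nonneg_iff_isPositive A).1 hA).inner_nonneg_right x
    simpa using (Complex.nonneg_iff.1 h).2.symm

theorem quad_toForm (A : E →L[ℂ] E) (hA : 0 ≤ A) (x : E) :
    (toForm A hA).quad x = (⟪A x, x⟫_ℂ).re := by
  rw [← inner_conj_symm, Complex.conj_re]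
  rfl

theorem nsmul_nonneg' (n : ℕ) {A : E →L[ℂ] E} (hA : 0 ≤ A) : 0 ≤ n • A := by
  induction n with
  | zero => simp
  | succ k ih =>
    rw [ContinuousLinearMap.nonneg_iff_isPositive] at hA ih ⊢
    rw [succ_nsmul]
    exact ih.add hA

variable [CompleteSpace E]

/-- A bounded nonnegative form on a Hilbert space is the form of a positive operator. -/
theorem exists_of_bounded (s : NonnegForm E) (C : ℝ) (hC : 0 ≤ C)
    (h : ∀ x, s.quad x ≤ C * ‖x‖ ^ 2) :
    ∃ S : E →L[ℂ] E, 0 ≤ S ∧ ∀ x y, ⟪y, S x⟫_ℂ = s x y := by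
  have hb : ∀ x y, ‖s x y‖ ≤ C * ‖x‖ * ‖y‖ := by
    intro x y
    refine abs_le_of_sq_le_sq' ?_ (by positivity) |>.2
    refine (s.norm_apply_sq_le x y).trans ((mul_le_mul (h x) (h y) (s.quad_nonneg y)
      (by positivity)).trans (le_of_eq (by ring)))
  let B : E →L⋆[ℂ] E →L[ℂ] ℂ := LinearMap.mkContinuous₂ s.toSesq.flip C fun y x => by
    simpa [mul_assoc, mul_comm, mul_left_comm] using hb x y
  refine ⟨(InnerProductSpace.continuousLinearMapOfBilin B).adjoint, ?_, ?_⟩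
  · rw [ContinuousLinearMap.nonneg_iff_isPositive, ContinuousLinearMap.isPositive_iff_complex]
    intro x
    rw [ContinuousLinearMap.adjoint_inner_left, ← inner_conj_symm,
      InnerProductSpace.continuousLinearMapOfBilin_apply]
    simp only [B, LinearMap.mkContinuous₂_apply, LinearMap.flip_apply]
    rw [s.conj_apply, s.apply_self]
    simpa using s.quad_nonneg x
  · intro x y
    rw [ContinuousLinearMap.adjoint_inner_right,
      InnerProductSpace.continuousLinearMapOfBilin_apply]
    rfl

theorem exists_of_le (A : E →L[ℂ] E) (hA : 0 ≤ A) (s : NonnegForm E) (h : s ≤ toForm A hA) :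
    ∃ S : E →L[ℂ] E, 0 ≤ S ∧ ∀ x, (⟪S x, x⟫_ℂ).re = s.quad x := by
  obtain ⟨S, hS, hs⟩ := exists_of_bounded s ‖A‖ (norm_nonneg _) fun x => by
    refine (h x).trans ?_
    rw [quad_toForm]
    refine (Complex.re_le_norm _).trans ((norm_inner_le_norm _ _).trans ?_)
    nlinarith [A.le_opNorm x, norm_nonneg x]
  refine ⟨S, hS, fun x => ?_⟩
  rw [← inner_conj_symm, Complex.conj_re, hs]
  rfl

theorem exists_parallelSum (A B : E →L[ℂ] E) (hA : 0 ≤ A) (hB : 0 ≤ B) :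
    ∃ S : E →L[ℂ] E, 0 ≤ S ∧
      ∀ x, (⟪S x, x⟫_ℂ).re = ⨅ y, ((⟪A (x - y), x - y⟫_ℂ).re + (⟪B y, y⟫_ℂ).re) := by
  obtain ⟨S, hS, hs⟩ := exists_of_le A hA _
    (NonnegForm.parallelSum_le_left (toForm A hA) (toForm B hB))
  refine ⟨S, hS, fun x => ?_⟩
  simp only [hs, NonnegForm.quad_parallelSum, quad_toForm]

/-- The parallel sum `A : B` of two positive operators, the positive operator with
`⟨(A : B) x, x⟩ = inf_y (⟨A (x - y), x - y⟩ + ⟨B y, y⟩)`. -/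
def parallelSum (A B : E →L[ℂ] E) (hA : 0 ≤ A) (hB : 0 ≤ B) : E →L[ℂ] E :=
  (exists_parallelSum A B hA hB).choose

theorem re_inner_parallelSum (A B : E →L[ℂ] E) (hA : 0 ≤ A) (hB : 0 ≤ B) (x : E) :
    (⟪parallelSum A B hA hB x, x⟫_ℂ).re
      = ⨅ y, ((⟪A (x - y), x - y⟫_ℂ).re + (⟪B y, y⟫_ℂ).re) :=
  (exists_parallelSum A B hA hB).choose_spec.2 x

theorem exists_short (A B : E →L[ℂ] E) (hA : 0 ≤ A) (hB : 0 ≤ B) :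
    ∃ S : E →L[ℂ] E, 0 ≤ S ∧ ∀ x, (⟪S x, x⟫_ℂ).re
      = ⨆ n : ℕ, (⟪parallelSum B (n • A) hB (nsmul_nonneg' n hA) x, x⟫_ℂ).re := by
  have hle : NonnegForm.short (toForm A hA) (toForm B hB) ≤ toForm B hB := fun x => by
    rw [NonnegForm.quad_short]
    exact ciSup_le fun n => NonnegForm.parallelSum_le_left _ _ x
  obtain ⟨S, hS, hs⟩ := exists_of_le B hB _ hle
  refine ⟨S, hS, fun x => ?_⟩
  rw [hs, NonnegForm.quad_short]
  congr 1
  funext n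
  rw [NonnegForm.quad_parallelSum, re_inner_parallelSum]
  congr 1
  funext y
  rw [NonnegForm.quad_nsmul, quad_toForm, quad_toForm, smul_apply,
    ← Nat.cast_smul_eq_nsmul ℂ, inner_smul_left]
  simp

/-- The generalized short `[A]B = sup_n (B : (n A))` of `B` with respect to `A`, where `A` and `B`
are positive operators. (The supremum of a bounded increasing sequence of positive operators is
the operator whose quadratic form is the pointwise supremum of their quadratic forms.) -/
def short (A B : E →L[ℂ] E) (hA : 0 ≤ A) (hB : 0 ≤ B) : E →L[ℂ] E :=
  (exists_short A B hA hB).choose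

theorem re_inner_short (A B : E →L[ℂ] E) (hA : 0 ≤ A) (hB : 0 ≤ B) (x : E) :
    (⟪short A B hA hB x, x⟫_ℂ).re
      = ⨆ n : ℕ, (⟪parallelSum B (n • A) hB (nsmul_nonneg' n hA) x, x⟫_ℂ).re :=
  (exists_short A B hA hB).choose_spec.2 x

end PosOp

end

/-! ### Inequalities for the generalized short; quasi-units, extreme points, disjoint parts -/

namespace NonnegForm

variable {X : Type*} [AddCommGroup X] [Module ℂ X]

/-! A form `w ≤ t` induces a contraction `J : H_t → H_w`, and `J* J` is the operator representing
it; conversely a positive contraction on `H_t` is pulled back to `X`. Since `X` has dense image in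
`H_t`, order and equality of operators, and the infima defining parallel sums, can be tested on that
image, which gives (1).

The tool for (2) and (3) is `le_short`: a form below `t` and below some multiple of `w` is below
`D_w t`. For (2) it shows that a quasi-unit is extreme. An extreme point is a disjoint part by
perturbing `w` to `w + r` and `w - r`. For a disjoint part with operator `T`, the operator `T - T²`
lies below `T` and `1 - T`, so it vanishes; `T` is then a projection, and `[T]1 ≤ T`.

In (3), comparable shorts give an infimum, namely the smaller one. Conversely, take `t = u + v`, so
the representing operators satisfy `A + B = 1`. With `P`, `Q` the positive and negative parts of `A
- B`, one has `A = M + P`, `B = M + Q`, `PQ = 0`, and `M` is the only candidate for the infimum. If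
`PM` and `QM` are both nonzero, an off-diagonal perturbation of `M` stays below `A` and `B` but not
below `M` (`eq_zero_or_eq_zero_of_forall_le`). If, say, `QM = 0`, every positive operator below `B`
and a multiple of `A` is below `M`, hence below `A`; this makes the shorts comparable. -/

theorem quad_smul (c : ℝ≥0) (t : NonnegForm X) (x : X) : (c • t).quad x = c * t.quad x := by
  change ((c • t.toSesq) x x).re = _
  simp [quad, NNReal.smul_def]

theorem quad_sub_form (t w : NonnegForm X) (h : w ≤ t) (x : X) :
    (t.sub w h).quad x = t.quad x - w.quad x := by
  simp [quad, sub]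

protected theorem nonneg (t : NonnegForm X) : 0 ≤ t := fun x => t.quad_nonneg x

theorem quad_sub_smul (s : NonnegForm X) (c : ℝ) (x y : X) :
    s.quad (x - (c : ℂ) • y) = s.quad x - 2 * c * (s x y).re + c ^ 2 * s.quad y := by
  have h : (s y x).re = (s x y).re := by rw [← s.conj_apply, Complex.conj_re]
  simp only [quad, map_sub, map_smul, LinearMap.sub_apply, LinearMap.smul_apply,
    LinearMap.map_smulₛₗ, Complex.conj_ofReal, smul_eq_mul, Complex.sub_re, Complex.re_ofReal_mul,
    h]
  ring

/-- The difference of the two sides is exactly `s[x - (k+1) y]`. For `k ≥ 0` this is the lower bound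
`k/(k+1) s ≤ s : (k s)`. -/
theorem mul_quad_le (s : NonnegForm X) (k : ℝ) (x y : X) :
    k * s.quad x ≤ (k + 1) * (s.quad (x - y) + k * s.quad y) := by
  have h1 := s.quad_nonneg (x - ((k + 1 : ℝ) : ℂ) • y)
  have h2 := s.quad_sub_smul 1 x y
  rw [quad_sub_smul] at h1
  simp only [Complex.ofReal_one, one_smul] at h2
  rw [h2]
  linarith

theorem parallelSum_le_right (t w : NonnegForm X) : parallelSum t w ≤ w := fun x => by
  rw [quad_parallelSum]
  refine (ciInf_le (bddBelow_parallelSum t w x) x).trans ?_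
  simp [quad]

theorem parallelSum_le_short (w t : NonnegForm X) (n : ℕ) :
    parallelSum t (n • w) ≤ short w t := fun x => by
  rw [quad_short]
  exact le_ciSup (f := fun n : ℕ => (parallelSum t (n • w)).quad x)
    ⟨t.quad x, by rintro _ ⟨n, rfl⟩; exact parallelSum_le_left _ _ x⟩ n

theorem short_le (w t : NonnegForm X) : short w t ≤ t := fun x => by
  rw [quad_short]
  exact ciSup_le fun n => parallelSum_le_left _ _ x

/-- Since `s ≤ t` and `(n/m) s ≤ n w`, the parallel sum `t : (n w)` dominates `s : ((n/m) s)`, which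
is at least `(n/m)/(n/m+1) s`; let `n → ∞`. -/
theorem le_short {s w t : NonnegForm X} {m : ℝ} (hm : 0 < m) (hst : s ≤ t)
    (hsw : ∀ x, s.quad x ≤ m * w.quad x) : s ≤ short w t := fun x => by
  have key : ∀ n : ℕ, (n / m) / (n / m + 1) * s.quad x ≤ (short w t).quad x := by
    intro n
    refine le_trans ?_ (parallelSum_le_short w t n x)
    rw [quad_parallelSum]
    refine le_ciInf fun y => ?_
    have h0 : (0 : ℝ) < n / m + 1 := by positivity
    have h1 := s.mul_quad_le (n / m) x y
    rw [div_mul_eq_mul_div, div_le_iff₀ h0, mul_comm _ (_ + 1 : ℝ)]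
    refine h1.trans (mul_le_mul_of_nonneg_left (add_le_add (hst _) ?_) h0.le)
    rw [quad_nsmul, div_mul_eq_mul_div, div_le_iff₀ hm]
    have := mul_le_mul_of_nonneg_left (hsw y) (Nat.cast_nonneg (α := ℝ) n)
    linarith
  have hlim : Filter.Tendsto (fun n : ℕ => ((n : ℝ) / m) / (n / m + 1) * s.quad x) Filter.atTop
      (nhds (1 * s.quad x)) := by
    refine Filter.Tendsto.mul_const _ ?_
    have : ∀ n : ℕ, ((n : ℝ) / m) / (n / m + 1) = n / (n + m) := fun n => by
      field_simp
    simp only [this]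
    exact tendsto_natCast_div_add_atTop m
  rw [one_mul] at hlim
  exact le_of_tendsto' hlim key

theorem le_short_of_le {s w t : NonnegForm X} (hst : s ≤ t) (hsw : s ≤ w) : s ≤ short w t :=
  le_short one_pos hst fun x => by simpa using hsw x

/-- `D_u v` lies below `v`, and the hypothesis puts it below `u`; by `le_short_of_le` it dominates
every common lower bound. -/
theorem exists_isGLB_of_short_le {u v : NonnegForm X} (h : short u v ≤ short v u) :
    ∃ s : NonnegForm X, IsGLB {u, v} s := by
  refine ⟨short u v, ?_, ?_⟩
  · rintro _ (rfl | rfl)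
    · exact h.trans (short_le _ _)
    · exact short_le _ _
  · intro s hs
    exact le_short_of_le (hs (by simp)) (hs (by simp))

theorem IsQuasiUnit.le_of_le_mul {s w t : NonnegForm X} (hw : w.IsQuasiUnit t) (hst : s ≤ t)
    {m : ℝ} (hm : 0 < m) (hsw : ∀ x, s.quad x ≤ m * w.quad x) : s ≤ w := by
  have h := le_short hm hst hsw
  rwa [show short w t = w from hw] at h

/-- If `w = α u + β v`, then `u ≤ α⁻¹ w` and `u ≤ t` force `u ≤ D_w t = w`; likewise `v ≤ w`. A
proper convex combination of forms below `w` equals `w` only if both do. -/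
theorem IsQuasiUnit.mem_extremePoints {w t : NonnegForm X} (hw : w.IsQuasiUnit t)
    (hwt : w ≤ t) : w ∈ (Set.Icc (0 : NonnegForm X) t).extremePoints ℝ≥0 := by
  have key : ∀ u ≤ t, ∀ v ≤ t, ∀ α β : ℝ≥0, 0 < α → 0 < β → α + β = 1 → α • u + β • v = w →
      u ≤ w := by
    intro u hu v hv α β hα hβ hab h
    have hα' : (0 : ℝ) < α := hα
    refine hw.le_of_le_mul hu (inv_pos.2 hα') fun x => ?_
    rw [inv_mul_eq_div, le_div_iff₀ hα', ← h, quad_add, quad_smul, quad_smul]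
    have := mul_nonneg β.2 (v.quad_nonneg x)
    change 0 ≤ (β : ℝ) * _ at this
    linarith
  refine ⟨⟨w.nonneg, hwt⟩, ?_⟩
  rintro u ⟨-, hu⟩ v ⟨-, hv⟩ ⟨α, β, hα, hβ, hab, h⟩
  have huw := key u hu v hv α β hα hβ hab h
  have hvw := key v hv u hu β α hβ hα (by rwa [add_comm]) (by rwa [add_comm])
  refine le_antisymm huw fun x => ?_
  have h1 : w.quad x = α * u.quad x + β * v.quad x := by
    rw [← h, quad_add, quad_smul, quad_smul]
  have h2 : (β : ℝ) = 1 - α := by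
    have : (α : ℝ) + β = 1 := by exact_mod_cast hab
    linarith
  have h3 := mul_le_mul_of_nonneg_left (hvw x) β.2
  change (β : ℝ) * _ ≤ β * _ at h3
  have hα' : (0 : ℝ) < α := hα
  rw [h2] at h1 h3
  nlinarith

/-- A common minorant `r` of `w` and `t - w` makes `w` the midpoint of `w + r` and `w - r`, both in
`[0, t]`. -/
theorem isDisjointPart_of_mem_extremePoints {w t : NonnegForm X}
    (hw : w ∈ (Set.Icc (0 : NonnegForm X) t).extremePoints ℝ≥0) : w.IsDisjointPart t := by
  obtain ⟨⟨-, hwt⟩, hext⟩ := hw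
  refine ⟨hwt, fun r hrw hrt => ?_⟩
  have hle : w + r ≤ t := fun x => by
    have := hrt x
    rw [quad_sub_form] at this
    rw [quad_add]
    linarith
  have hmid : (2⁻¹ : ℝ≥0) • (w + r) + (2⁻¹ : ℝ≥0) • (w.sub r hrw) = w := by
    refine ext_quad fun x => ?_
    rw [quad_add, quad_smul, quad_smul, quad_add, quad_sub_form]
    push_cast
    ring
  have h := hext (x₁ := w + r) ⟨NonnegForm.nonneg _, hle⟩ (x₂ := w.sub r hrw)
    ⟨NonnegForm.nonneg _, fun x => by
      rw [quad_sub_form]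
      have := hwt x
      have := r.quad_nonneg x
      linarith⟩
    ⟨2⁻¹, 2⁻¹, by simp, by simp, by
      rw [← two_mul]
      exact mul_inv_cancel₀ two_ne_zero, hmid⟩
  refine ext_quad fun x => ?_
  have h' := congrArg (fun s => s.quad x) h
  simp only [quad_add] at h'
  rw [quad_zero]
  linarith

/-- The form `(x, y) ↦ s (f x) (f y)`. -/
def comap {Y : Type*} [AddCommGroup Y] [Module ℂ Y] (s : NonnegForm Y) (f : X →ₗ[ℂ] Y) :
    NonnegForm X where
  toSesq := LinearMap.mk₂'ₛₗ (RingHom.id ℂ) (starRingEnd ℂ) (fun x y => s (f x) (f y))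
    (fun x y z => by simp) (fun c x y => by simp) (fun x y z => by simp) (fun c x y => by simp)
  re_nonneg' x := s.re_nonneg' (f x)
  im_eq_zero' x := s.im_eq_zero' (f x)

theorem denseRange_toH (t : NonnegForm X) : DenseRange t.toH :=
  UniformSpace.Completion.denseRange_coe.comp
    (SeparationQuotient.surjective_mk.denseRange.comp t.toPre.surjective.denseRange
      SeparationQuotient.continuous_mk) (UniformSpace.Completion.continuous_coe _)

end NonnegForm

/-! ### Positive operators: order, squares and orthogonality -/

namespace ContinuousLinearMap

variable {E : Type*} [NormedAddCommGroup E] [InnerProductSpace ℂ E] [CompleteSpace E]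

theorem nonneg_iff_forall_re_inner {A : E →L[ℂ] E} (hA : IsSelfAdjoint A) :
    0 ≤ A ↔ ∀ x, 0 ≤ (⟪A x, x⟫_ℂ).re := by
  rw [nonneg_iff_isPositive, isPositive_def']
  exact and_iff_right hA

theorem le_iff_forall_re_inner {A B : E →L[ℂ] E} (hA : IsSelfAdjoint A) (hB : IsSelfAdjoint B) :
    A ≤ B ↔ ∀ x, (⟪A x, x⟫_ℂ).re ≤ (⟪B x, x⟫_ℂ).re := by
  rw [← sub_nonneg, nonneg_iff_forall_re_inner (hB.sub hA)]
  simp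

theorem le_iff_forall_re_inner_of_denseRange {ι : Type*} {f : ι → E} (hf : DenseRange f)
    {A B : E →L[ℂ] E} (hA : IsSelfAdjoint A) (hB : IsSelfAdjoint B) :
    A ≤ B ↔ ∀ i, (⟪A (f i), f i⟫_ℂ).re ≤ (⟪B (f i), f i⟫_ℂ).re := by
  rw [le_iff_forall_re_inner hA hB]
  refine ⟨fun h i => h (f i), fun h x => ?_⟩
  refine hf.induction_on (p := fun x => (⟪A x, x⟫_ℂ).re ≤ (⟪B x, x⟫_ℂ).re) x
    (isClosed_le ?_ ?_) h <;> fun_prop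

theorem eq_of_forall_re_inner_of_denseRange {ι : Type*} {f : ι → E} (hf : DenseRange f)
    {A B : E →L[ℂ] E} (hA : IsSelfAdjoint A) (hB : IsSelfAdjoint B)
    (h : ∀ i, (⟪A (f i), f i⟫_ℂ).re = (⟪B (f i), f i⟫_ℂ).re) : A = B :=
  le_antisymm ((le_iff_forall_re_inner_of_denseRange hf hA hB).2 fun i => (h i).le)
    ((le_iff_forall_re_inner_of_denseRange hf hB hA).2 fun i => (h i).ge)

theorem re_inner_self_nonneg {A : E →L[ℂ] E} (hA : 0 ≤ A) (x : E) : 0 ≤ (⟪A x, x⟫_ℂ).re :=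
  (nonneg_iff_forall_re_inner (.of_nonneg hA)).1 hA x

theorem _root_.IsSelfAdjoint.inner_apply_left {A : E →L[ℂ] E} (hA : IsSelfAdjoint A) (x y : E) :
    ⟪A x, y⟫_ℂ = ⟪x, A y⟫_ℂ :=
  isSelfAdjoint_iff_isSymmetric.1 hA x y

theorem re_inner_mul_self {A : E →L[ℂ] E} (hA : IsSelfAdjoint A) (x : E) :
    (⟪(A * A) x, x⟫_ℂ).re = ‖A x‖ ^ 2 := by
  rw [@norm_sq_eq_re_inner ℂ, ← hA.inner_apply_left]
  rfl

/-- `A - A² = A(1 - A)A + (1 - A)A(1 - A)`. -/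
theorem sub_mul_self_nonneg {A : E →L[ℂ] E} (h0 : 0 ≤ A) (h1 : A ≤ 1) : 0 ≤ A - A * A := by
  have h1' := sub_nonneg.2 h1
  have := add_nonneg (conjugate_nonneg_of_nonneg h1' h0) (conjugate_nonneg_of_nonneg h0 h1')
  convert this using 1
  noncomm_ring

theorem mul_self_le_self {A : E →L[ℂ] E} (h0 : 0 ≤ A) (h1 : A ≤ 1) : A * A ≤ A :=
  sub_nonneg.1 (sub_mul_self_nonneg h0 h1)

theorem mul_self_nonneg_of_isSelfAdjoint {A : E →L[ℂ] E} (hA : IsSelfAdjoint A) : 0 ≤ A * A := by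
  have := star_mul_self_nonneg A
  rwa [hA.star_eq] at this

theorem sub_mul_self_le_self {A : E →L[ℂ] E} (hA : IsSelfAdjoint A) : A - A * A ≤ A :=
  sub_le_self _ (mul_self_nonneg_of_isSelfAdjoint hA)

theorem sub_mul_self_le_one_sub {A : E →L[ℂ] E} (hA : IsSelfAdjoint A) : A - A * A ≤ 1 - A := by
  -- The gap `(1 - A) - (A - A²)` is `(1 - A)²`.
  have := mul_self_nonneg_of_isSelfAdjoint ((IsSelfAdjoint.one _).sub hA)
  rw [← sub_nonneg]
  convert this using 1
  noncomm_ring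

theorem ofReal_smul_nonneg {c : ℝ} (hc : 0 ≤ c) {A : E →L[ℂ] E} (hA : 0 ≤ A) :
    0 ≤ (c : ℂ) • A := by
  rw [Complex.coe_smul]
  exact smul_nonneg hc hA

/-- A positive operator dominated by a positive operator vanishes where the latter does. -/
theorem mul_eq_zero_of_le {S A Q : E →L[ℂ] E} (hS : 0 ≤ S) (hQ : 0 ≤ Q) (h : S ≤ A)
    (hA : A * Q = 0) : S * Q = 0 := by
  have h1 : Q * S * Q = 0 := by
    refine le_antisymm ?_ (conjugate_nonneg_of_nonneg hS hQ)
    have := conjugate_le_conjugate_of_nonneg h hQ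
    rwa [mul_assoc Q A, hA, mul_zero] at this
  obtain ⟨b, rfl⟩ := CStarAlgebra.nonneg_iff_eq_star_mul_self.1 hS
  have hQ' : star Q = Q := IsSelfAdjoint.of_nonneg hQ
  have h2 : b * Q = 0 := by
    rw [← CStarRing.star_mul_self_eq_zero_iff, star_mul, hQ']
    simpa only [mul_assoc] using h1
  rw [mul_assoc, h2, mul_zero]

/-- Two positive operators with product zero are disjoint. -/
theorem eq_zero_of_le_of_mul_eq_zero {K P Q : E →L[ℂ] E} (hQ : 0 ≤ Q)
    (hPQ : P * Q = 0) (hK : 0 ≤ K) (hKP : K ≤ P) (hKQ : K ≤ Q) : K = 0 := by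
  have h1 := mul_eq_zero_of_le hK hQ hKP hPQ
  have h2 : Q * K = 0 := by
    have := congrArg star h1
    rwa [star_mul, star_zero, IsSelfAdjoint.of_nonneg hQ, IsSelfAdjoint.of_nonneg hK] at this
  have h3 := mul_eq_zero_of_le hK hK hKQ h2
  rw [← CStarRing.star_mul_self_eq_zero_iff, IsSelfAdjoint.of_nonneg hK, h3]

/-- If `N` vanishes on the range of the self-adjoint operator `Q`, then positivity of `N + Q`
implies positivity of `N`. -/
theorem nonneg_of_add_nonneg_of_mul_eq_zero {N Q : E →L[ℂ] E} (hN : IsSelfAdjoint N)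
    (hQ : IsSelfAdjoint Q) (h : 0 ≤ N + Q) (hNQ : N * Q = 0) : 0 ≤ N := by
  rw [nonneg_iff_forall_re_inner hN]
  intro x
  let K : Submodule ℂ E := Q.toLinearMap.ker
  have : CompleteSpace K := (Q.isClosed_ker).completeSpace_coe
  obtain ⟨k, hk, r, hr, rfl⟩ := K.exists_add_mem_mem_orthogonal x
  -- Taking adjoints, `QN = 0`, so the range of `N` lies in `ker Q` and is orthogonal to `r`. Thus
  -- only `k` contributes to the quadratic form of `N`, and there `N` agrees with `N + Q`.
  have hNr : N r = 0 := by
    refine ext_inner_left ℂ fun z => ?_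
    rw [inner_zero_right, ← hN.inner_apply_left]
    refine (Submodule.mem_orthogonal _ _).1 hr _ ?_
    change Q (N z) = 0
    have := congrArg star hNQ
    rw [star_mul, star_zero, hN.star_eq, hQ.star_eq] at this
    exact congrArg (fun T : E →L[ℂ] E => T z) this
  have hQk : Q k = 0 := hk
  have h1 := re_inner_self_nonneg h k
  rw [add_apply, hQk, add_zero] at h1
  have h2 : ⟪N k, r⟫_ℂ = 0 := by
    rw [hN.inner_apply_left, hNr, inner_zero_right]
  rw [map_add, hNr, add_zero, inner_add_right, h2, add_zero]
  exact h1

/-! ### Infima of two positive operators with sum `1` -/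

/-- Two positive operators with sum `1` are, up to a common positive summand, disjoint. -/
theorem exists_disjoint_decomposition {A B : E →L[ℂ] E} (hA : 0 ≤ A) (hB : 0 ≤ B)
    (hAB : A + B = 1) : ∃ M P Q : E →L[ℂ] E, 0 ≤ M ∧ 0 ≤ P ∧ 0 ≤ Q ∧ A = M + P ∧ B = M + Q ∧
      P * Q = 0 ∧ Q * P = 0 := by
  have hT : IsSelfAdjoint (A - B) := (IsSelfAdjoint.of_nonneg hA).sub (.of_nonneg hB)
  have hP := CFC.posPart_nonneg (A - B)
  have hQ := CFC.negPart_nonneg (A - B)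
  have hPQ := CFC.posPart_mul_negPart (A - B)
  have hQP := CFC.negPart_mul_posPart (A - B)
  have hdec := CFC.posPart_sub_negPart (A - B) hT
  set P := (A - B)⁺
  set Q := (A - B)⁻
  have hB' : B = A - P + Q := by
    have h : A - B - (A - B) = P - Q - (A - B) := by rw [hdec]
    rw [← sub_eq_zero]
    rw [sub_self] at h
    rw [h]
    abel
  refine ⟨A - P, P, Q, ?_, hP, hQ, by abel, hB', hPQ, hQP⟩
  -- `P + Q = |A - B|`, and `(A - B)² = (2A - 1)² = 1 - 4(A - A²)`.
  have hL : (P + Q) * (P + Q) ≤ 1 := by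
    have h1 : (P + Q) * (P + Q) = (A - B) * (A - B) := by
      rw [← hdec]
      simp only [mul_add, add_mul, mul_sub, sub_mul, hPQ, hQP]
      abel
    have h2 : A ≤ 1 := by
      rw [← hAB]
      exact le_add_of_nonneg_right hB
    have h3 : (A - B) * (A - B) = 4 • (A * A - A) + 1 := by
      rw [← sub_eq_iff_eq_add'.2 hAB.symm]
      noncomm_ring
    rw [h1, h3]
    have h4 : 0 ≤ 4 • (A - A * A) := nsmul_nonneg (sub_nonneg.2 (mul_self_le_self hA h2)) 4
    rw [← sub_nonneg]
    convert h4 using 1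
    noncomm_ring
  have hL0 : 0 ≤ P + Q := add_nonneg hP hQ
  -- The square root of the bound is taken through norms, by the C*-identity.
  have hL1 : P + Q ≤ 1 := by
    rw [← CStarAlgebra.norm_le_one_iff_of_nonneg _ hL0]
    have h0 : 0 ≤ (P + Q) * (P + Q) := by
      simpa using conjugate_nonneg_of_nonneg (zero_le_one (α := E →L[ℂ] E)) hL0
    rw [← CStarAlgebra.norm_le_one_iff_of_nonneg _ h0] at hL
    have h1 := CStarRing.norm_star_mul_self (x := P + Q)
    rw [IsSelfAdjoint.of_nonneg hL0] at h1
    rw [h1] at hL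
    nlinarith [norm_nonneg (P + Q)]
  have h2 : A - P = (2⁻¹ : ℝ) • (1 - (P + Q)) := by
    have : (2 : ℝ) • (A - P) = 1 - (P + Q) := by
      have h : A - P + (A - P) = A + (A - P + Q) - (P + Q) := by abel
      rw [← hAB, two_smul, h, ← hB']
    rw [← this, smul_smul]
    norm_num
  rw [h2]
  exact smul_nonneg (by norm_num) (sub_nonneg.2 hL1)

/-- A vector `p y` is killed by `q`, and `p (p y) ≠ 0` when `p y ≠ 0` because `p` is self-adjoint;
then normalize. -/
theorem exists_unit_image {p q : E →L[ℂ] E} (hp : IsSelfAdjoint p) (hqp : q * p = 0)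
    (h : p ≠ 0) : ∃ x, ‖p x‖ = 1 ∧ q x = 0 := by
  obtain ⟨y, hy⟩ : ∃ y, p y ≠ 0 := by
    by_contra! hc
    exact h (ext hc)
  have ha : p (p y) ≠ 0 := fun h0 => hy <| by
    rw [← inner_self_eq_zero (𝕜 := ℂ), hp.inner_apply_left, h0, inner_zero_right]
  refine ⟨((‖p (p y)‖⁻¹ : ℝ) : ℂ) • p y, ?_, ?_⟩
  · rw [map_smul, norm_smul, Complex.norm_real, norm_inv, norm_norm]
    exact inv_mul_cancel₀ (norm_ne_zero_iff.2 ha)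
  · rw [map_smul, show q (p y) = (q * p) y from rfl, hqp, zero_apply, smul_zero]

theorem re_inner_real_smul {F : Type*} [NormedAddCommGroup F] [InnerProductSpace ℂ F] (r : ℝ)
    (A : F →L[ℂ] F) (x : F) :
    (⟪(r • A) x, x⟫_ℂ).re = r * (⟪A x, x⟫_ℂ).re := by
  rw [smul_apply, ← Complex.coe_smul, inner_smul_left, Complex.conj_ofReal, Complex.re_ofReal_mul]

/-- If `M` dominates every positive operator below `M + P` and `M + Q`, then one cannot find
nonzero orthogonal square roots of operators below `P` and `Q` inside `M`. -/
theorem eq_zero_or_eq_zero_of_forall_le {M P Q p q : E →L[ℂ] E} (hM : 0 ≤ M) (hP : 0 ≤ P)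
    (hQ : 0 ≤ Q) (hp : IsSelfAdjoint p) (hq : IsSelfAdjoint q) (hpq : p * q = 0)
    (hqp : q * p = 0) (hpP : p * p ≤ P) (hqQ : q * q ≤ Q) (hpqM : p * p + q * q ≤ M)
    (hinf : ∀ D, 0 ≤ D → D ≤ M + P → D ≤ M + Q → D ≤ M) : p = 0 ∨ q = 0 := by
  by_contra! hne
  obtain ⟨x₁, hx₁, hqx₁⟩ := exists_unit_image hp hqp hne.1
  obtain ⟨x₂, hx₂, hpx₂⟩ := exists_unit_image hq hpq hne.2
  -- Rank-one partial isometry taking the unit vector `q x₂` to the unit vector `p x₁`.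
  let R : E →L[ℂ] E := (innerSL ℂ (q x₂)).smulRight (p x₁)
  have hRz : ∀ z, R z = ⟪q x₂, z⟫_ℂ • p x₁ := fun z => rfl
  let Y : E →L[ℂ] E := p * R * q
  -- Modelled on the matrix with diagonal `-1/3` and off-diagonal `2/3`: its eigenvalues are `1/3`
  -- and `-1`, so it is at least `-1` but not negative, and it lies below both `diag(1, 0)` and
  -- `diag(0, 1)`.
  let X : E →L[ℂ] E := (2 / 3 : ℝ) • (Y + star Y) - (1 / 3 : ℝ) • (p * p + q * q)
  have hpp : IsSelfAdjoint (p * p) := by rw [IsSelfAdjoint, star_mul, hp.star_eq]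
  have hqq : IsSelfAdjoint (q * q) := by rw [IsSelfAdjoint, star_mul, hq.star_eq]
  have hX : IsSelfAdjoint X :=
    ((IsSelfAdjoint.all _).smul (IsSelfAdjoint.add_star_self Y)).sub
      ((IsSelfAdjoint.all _).smul (hpp.add hqq))
  have hXq : ∀ x, (⟪X x, x⟫_ℂ).re
      = 4 / 3 * (⟪R (q x), p x⟫_ℂ).re - 1 / 3 * (‖p x‖ ^ 2 + ‖q x‖ ^ 2) := by
    intro x
    have h1 : (⟪Y x, x⟫_ℂ).re = (⟪R (q x), p x⟫_ℂ).re := by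
      rw [← hp.inner_apply_left]
      rfl
    have h2 : (⟪star Y x, x⟫_ℂ).re = (⟪Y x, x⟫_ℂ).re := by
      rw [star_eq_adjoint, adjoint_inner_left, ← inner_conj_symm, Complex.conj_re]
    rw [sub_apply, inner_sub_left, Complex.sub_re, re_inner_real_smul, re_inner_real_smul,
      add_apply, add_apply, inner_add_left, inner_add_left, Complex.add_re, Complex.add_re,
      re_inner_mul_self hp, re_inner_mul_self hq, h2, h1]
    ring
  have hR : ∀ x, |(⟪R (q x), p x⟫_ℂ).re| ≤ ‖q x‖ * ‖p x‖ := by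
    intro x
    refine (Complex.abs_re_le_norm _).trans ((norm_inner_le_norm _ _).trans ?_)
    refine mul_le_mul_of_nonneg_right ?_ (norm_nonneg _)
    rw [hRz, norm_smul, hx₁, mul_one]
    simpa [hx₂] using norm_inner_le_norm (𝕜 := ℂ) (q x₂) (q x)
  have sM := IsSelfAdjoint.of_nonneg hM
  have sP := IsSelfAdjoint.of_nonneg hP
  have sQ := IsSelfAdjoint.of_nonneg hQ
  have key : M + X ≤ M := by
    apply hinf
    · rw [nonneg_iff_forall_re_inner (sM.add hX)]
      intro x
      have h1 := (le_iff_forall_re_inner (hpp.add hqq) sM).1 hpqM x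
      rw [add_apply, inner_add_left, Complex.add_re, re_inner_mul_self hp,
        re_inner_mul_self hq] at h1
      rw [add_apply, inner_add_left, Complex.add_re, hXq]
      have h2 := abs_le.1 (hR x)
      nlinarith [sq_nonneg (‖q x‖ - ‖p x‖)]
    · rw [add_le_add_iff_left, le_iff_forall_re_inner hX sP]
      intro x
      have h1 := (le_iff_forall_re_inner hpp sP).1 hpP x
      rw [re_inner_mul_self hp] at h1
      rw [hXq]
      have h2 := abs_le.1 (hR x)
      nlinarith [sq_nonneg (‖q x‖ - 2 * ‖p x‖)]
    · rw [add_le_add_iff_left, le_iff_forall_re_inner hX sQ]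
      intro x
      have h1 := (le_iff_forall_re_inner hqq sQ).1 hqQ x
      rw [re_inner_mul_self hq] at h1
      rw [hXq]
      have h2 := abs_le.1 (hR x)
      nlinarith [sq_nonneg (2 * ‖q x‖ - ‖p x‖)]
  have h0 : X ≤ 0 := by simpa using key
  -- On `x₁ + x₂` the form of `X` equals `4/3 - 2/3 > 0`.
  have h1 := (le_iff_forall_re_inner hX (.zero _)).1 h0 (x₁ + x₂)
  have e1 : q (x₁ + x₂) = q x₂ := by rw [map_add, hqx₁, zero_add]
  have e2 : p (x₁ + x₂) = p x₁ := by rw [map_add, hpx₂, add_zero]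
  rw [hXq, e1, e2, hRz, inner_self_eq_norm_sq_to_K, hx₁, hx₂] at h1
  simp [inner_self_eq_norm_sq_to_K, hx₁] at h1
  norm_num at h1

/-- If `A + B = 1` and `A`, `B` have an infimum among the positive operators, then all positive
operators below `B` and a multiple of `A` lie below `A`, or the other way around. -/
theorem le_or_le_of_exists_inf {A B C : E →L[ℂ] E} (hA : 0 ≤ A) (hB : 0 ≤ B) (hAB : A + B = 1)
    (hCA : C ≤ A) (hCB : C ≤ B) (hC : ∀ D, 0 ≤ D → D ≤ A → D ≤ B → D ≤ C) :
    (∀ (S : E →L[ℂ] E) (n : ℕ), 0 ≤ S → S ≤ B → S ≤ n • A → S ≤ A) ∨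
      ∀ (S : E →L[ℂ] E) (n : ℕ), 0 ≤ S → S ≤ A → S ≤ n • B → S ≤ B := by
  obtain ⟨M, P, Q, hM, hP, hQ, rfl, rfl, hPQ, hQP⟩ := exists_disjoint_decomposition hA hB hAB
  -- `M` is a common lower bound, so `M ≤ C`; and `C - M` lies below both `P` and `Q`, whose product
  -- is zero.
  have hCM : C = M := by
    have h := hC M hM (le_add_of_nonneg_right hP) (le_add_of_nonneg_right hQ)
    refine sub_eq_zero.1 (eq_zero_of_le_of_mul_eq_zero hQ hPQ (sub_nonneg.2 h) ?_ ?_)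
    · rwa [sub_le_iff_le_add']
    · rwa [sub_le_iff_le_add']
  subst hCM
  -- This formula is what makes `C` commute with `P` and `Q`, so that `PC` and `QC` are
  -- self-adjoint.
  have hM2 : C = (2⁻¹ : ℝ) • (1 - (P + Q)) := by
    have : (2 : ℝ) • C = 1 - (P + Q) := by
      rw [← hAB, two_smul]
      abel
    rw [← this, smul_smul]
    norm_num
  have cP : P * C = C * P := by
    rw [hM2, mul_smul_comm, smul_mul_assoc]
    simp only [mul_sub, sub_mul, mul_add, add_mul, hPQ, hQP, mul_one, one_mul]
  have cQ : Q * C = C * Q := by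
    rw [hM2, mul_smul_comm, smul_mul_assoc]
    simp only [mul_sub, sub_mul, mul_add, add_mul, hPQ, hQP, mul_one, one_mul]
  have sC := IsSelfAdjoint.of_nonneg hM
  have sP := IsSelfAdjoint.of_nonneg hP
  have sQ := IsSelfAdjoint.of_nonneg hQ
  have hC1 : C ≤ 1 := by
    rw [← hAB, add_assoc]
    exact le_add_of_nonneg_right (add_nonneg hP hB)
  have hL1 : P + Q ≤ 1 := by
    rw [← hAB, add_add_add_comm]
    exact le_add_of_nonneg_left (add_nonneg hM hM)
  have hP1 : P ≤ 1 := (le_add_of_nonneg_right hQ).trans hL1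
  have hQ1 : Q ≤ 1 := (le_add_of_nonneg_left hP).trans hL1
  have hCC : C * C ≤ 1 := (mul_self_le_self hM hC1).trans hC1
  -- `(RC)² = R C² R ≤ R² ≤ R`.
  have hsq : ∀ {R : E →L[ℂ] E}, 0 ≤ R → R ≤ 1 → R * C = C * R → (R * C) * (R * C) ≤ R := by
    intro R hR hR1 hRC
    have h := conjugate_le_conjugate_of_nonneg hCC hR
    rw [mul_one] at h
    refine le_trans (le_of_eq ?_) (h.trans (mul_self_le_self hR hR1))
    nth_rw 2 [hRC]
    noncomm_ring
  -- The left side is `C (P + Q)² C ≤ C² ≤ C`.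
  have hsum : (P * C) * (P * C) + (Q * C) * (Q * C) ≤ C := by
    have h := conjugate_le_conjugate_of_nonneg
      ((mul_self_le_self (add_nonneg hP hQ) hL1).trans hL1) hM
    rw [mul_one] at h
    refine le_trans (le_of_eq ?_) (h.trans (mul_self_le_self hM hC1))
    simp only [mul_add, add_mul, hPQ, hQP, add_zero, zero_add]
    nth_rw 1 [cP]
    nth_rw 1 [cQ]
    noncomm_ring
  -- Here `Q` annihilates `C + P`, hence also `S`. So `C - S` vanishes on the range of `Q`, and `S ≤
  -- C + Q` improves to `S ≤ C`.
  have aux : ∀ {P Q : E →L[ℂ] E}, 0 ≤ P → 0 ≤ Q → P * Q = 0 → Q * C = 0 → C * Q = 0 →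
      ∀ (S : E →L[ℂ] E) (n : ℕ), 0 ≤ S → S ≤ C + Q → S ≤ n • (C + P) → S ≤ C + P := by
    intro P Q hP hQ hPQ hQC hCQ S n hS hSB hSA
    have hSQ : S * Q = 0 := mul_eq_zero_of_le hS hQ hSA (by
      rw [smul_mul_assoc, add_mul, hCQ, hPQ, add_zero, smul_zero])
    have h1 := nonneg_of_add_nonneg_of_mul_eq_zero (N := C - S) (Q := Q)
      (sC.sub (.of_nonneg hS)) (.of_nonneg hQ)
      (by rw [sub_add_eq_add_sub]; exact sub_nonneg.2 hSB) (by rw [sub_mul, hCQ, hSQ, sub_zero])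
    exact (sub_nonneg.1 h1).trans (le_add_of_nonneg_right hP)
  rcases eq_zero_or_eq_zero_of_forall_le (p := P * C) (q := Q * C) hM hP hQ
    (by rw [IsSelfAdjoint, star_mul, sC.star_eq, sP.star_eq, cP])
    (by rw [IsSelfAdjoint, star_mul, sC.star_eq, sQ.star_eq, cQ])
    (by rw [cP, mul_assoc, ← mul_assoc P, hPQ, zero_mul, mul_zero])
    (by rw [cQ, mul_assoc, ← mul_assoc Q, hQP, zero_mul, mul_zero])
    (hsq hP hP1 cP) (hsq hQ hQ1 cQ) hsum hC with h | h
  · exact Or.inr (aux hQ hP hQP h (by rw [← cP, h]))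
  · exact Or.inl (aux hP hQ hPQ h (by rw [← cQ, h]))

end ContinuousLinearMap

/-! ### Parallel sums and shorts computed on a dense subspace -/

theorem DenseRange.ciInf_comp {ι E : Type*} [Nonempty ι] [TopologicalSpace E] {f : ι → E}
    (hf : DenseRange f) {g : E → ℝ} (hg : Continuous g) (hb : BddBelow (Set.range g)) :
    ⨅ i, g (f i) = ⨅ y, g y := by
  have hb' : BddBelow (Set.range fun i => g (f i)) := hb.mono (Set.range_comp_subset_range f g)
  have : Nonempty E := ⟨f (Classical.arbitrary ι)⟩
  refine le_antisymm (le_ciInf fun y => ?_) (le_ciInf fun i => ciInf_le hb (f i))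
  exact hf.induction_on (p := fun y => ⨅ i, g (f i) ≤ g y) y (isClosed_le continuous_const hg)
    fun i => ciInf_le hb' i

namespace PosOp

variable {E : Type*} [NormedAddCommGroup E] [InnerProductSpace ℂ E] [CompleteSpace E]

theorem parallelSum_nonneg (A B : E →L[ℂ] E) (hA : 0 ≤ A) (hB : 0 ≤ B) :
    0 ≤ parallelSum A B hA hB :=
  (exists_parallelSum A B hA hB).choose_spec.1

theorem short_nonneg (A B : E →L[ℂ] E) (hA : 0 ≤ A) (hB : 0 ≤ B) : 0 ≤ short A B hA hB :=
  (exists_short A B hA hB).choose_spec.1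

theorem re_inner_nsmul {F : Type*} [NormedAddCommGroup F] [InnerProductSpace ℂ F] (n : ℕ)
    (A : F →L[ℂ] F) (x : F) :
    (⟪(n • A) x, x⟫_ℂ).re = n * (⟪A x, x⟫_ℂ).re := by
  rw [smul_apply, ← Nat.cast_smul_eq_nsmul ℂ, inner_smul_left]
  simp

/-- The form takes its infimum over `X`, the operator over all of `E`; the minimized expression is
continuous in `y`, so density of the image makes the two agree. -/
theorem quad_parallelSum_of_denseRange {X : Type*} [AddCommGroup X] [Module ℂ X]
    {f : X →ₗ[ℂ] E} (hf : DenseRange f) {u v : NonnegForm X} {A B : E →L[ℂ] E} (hA : 0 ≤ A)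
    (hB : 0 ≤ B) (hu : ∀ x, u.quad x = (⟪A (f x), f x⟫_ℂ).re)
    (hv : ∀ x, v.quad x = (⟪B (f x), f x⟫_ℂ).re) (x : X) :
    (u.parallelSum v).quad x = (⟪parallelSum A B hA hB (f x), f x⟫_ℂ).re := by
  rw [NonnegForm.quad_parallelSum, re_inner_parallelSum]
  simp only [hu, hv, map_sub]
  refine hf.ciInf_comp (g := fun y => (⟪A (f x) - A y, f x - y⟫_ℂ).re + (⟪B y, y⟫_ℂ).re)
    (by fun_prop) ⟨0, ?_⟩
  rintro _ ⟨y, rfl⟩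
  have h := ContinuousLinearMap.re_inner_self_nonneg hA (f x - y)
  rw [map_sub] at h
  exact add_nonneg h (ContinuousLinearMap.re_inner_self_nonneg hB y)

theorem quad_short_of_denseRange {X : Type*} [AddCommGroup X] [Module ℂ X]
    {f : X →ₗ[ℂ] E} (hf : DenseRange f) {u v : NonnegForm X} {A B : E →L[ℂ] E} (hA : 0 ≤ A)
    (hB : 0 ≤ B) (hu : ∀ x, u.quad x = (⟪A (f x), f x⟫_ℂ).re)
    (hv : ∀ x, v.quad x = (⟪B (f x), f x⟫_ℂ).re) (x : X) :
    (NonnegForm.short u v).quad x = (⟪short A B hA hB (f x), f x⟫_ℂ).re := by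
  rw [NonnegForm.quad_short, re_inner_short]
  congr 1
  funext n
  refine quad_parallelSum_of_denseRange hf hB (nsmul_nonneg' n hA) hv (fun y => ?_) x
  rw [NonnegForm.quad_nsmul, re_inner_nsmul, hu]

/-- `[P]1 ≤ P` for an orthogonal projection `P`. -/
theorem short_one_le_of_isIdempotent {P : E →L[ℂ] E} (hP : 0 ≤ P) (h1 : (0 : E →L[ℂ] E) ≤ 1)
    (hPP : P * P = P) : short P 1 hP h1 ≤ P := by
  rw [ContinuousLinearMap.le_iff_forall_re_inner (.of_nonneg (short_nonneg P 1 hP h1))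
    (.of_nonneg hP)]
  intro x
  rw [re_inner_short]
  refine ciSup_le fun n => ?_
  rw [re_inner_parallelSum]
  have hPx : P (P x) = P x := congrArg (fun T : E →L[ℂ] E => T x) hPP
  have hb : BddBelow (Set.range fun y => (⟪(1 : E →L[ℂ] E) (x - y), x - y⟫_ℂ).re
      + (⟪(n • P) y, y⟫_ℂ).re) := by
    refine ⟨0, ?_⟩
    rintro _ ⟨y, rfl⟩
    exact add_nonneg (ContinuousLinearMap.re_inner_self_nonneg h1 _)
      (ContinuousLinearMap.re_inner_self_nonneg (nsmul_nonneg' n hP) _)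
  -- At `y = x - P x` the term `n ⟨P y, y⟩` vanishes for every `n`, leaving `‖P x‖² = ⟨P x, x⟩`.
  refine (ciInf_le hb (x - P x)).trans (le_of_eq ?_)
  have h2 : P (x - P x) = 0 := by rw [map_sub, hPx, sub_self]
  have h3 : ⟪P x, P x⟫_ℂ = ⟪P x, x⟫_ℂ := by
    rw [(IsSelfAdjoint.of_nonneg hP).inner_apply_left, hPx,
      (IsSelfAdjoint.of_nonneg hP).inner_apply_left]
  rw [re_inner_nsmul, h2, inner_zero_left, Complex.zero_re, mul_zero, add_zero, sub_sub_cancel,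
    one_apply_eq_self, h3]

end PosOp

/-! ### The correspondence between `[0, t]` and operators on `H_t` -/

namespace NonnegForm

variable {X : Type*} [AddCommGroup X] [Module ℂ X] (t : NonnegForm X)

/-- The embedding of `H_t` into `H_w` for `w ≤ t`. -/
noncomputable def HMap (w : NonnegForm X) : t.H →L[ℂ] w.H := w.toH.extendOfNorm t.toH

theorem HMap_toH {w : NonnegForm X} (h : w ≤ t) (x : X) : t.HMap w (t.toH x) = w.toH x := by
  -- The constant `1` in the norm bound is the inequality `w ≤ t`.
  refine LinearMap.extendOfNorm_eq t.denseRange_toH ⟨1, fun x => ?_⟩ x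
  rw [one_mul]
  refine le_of_sq_le_sq ?_ (norm_nonneg _)
  rw [norm_toH_sq, norm_toH_sq]
  exact h x

/-- The operator on `H_t` that represents a form `w ≤ t`. -/
noncomputable def toOp (w : NonnegForm X) : t.H →L[ℂ] t.H := (t.HMap w).adjoint ∘L t.HMap w

theorem toOp_nonneg (w : NonnegForm X) : 0 ≤ t.toOp w :=
  (ContinuousLinearMap.nonneg_iff_isPositive _).2
    (ContinuousLinearMap.isPositive_adjoint_comp_self _)

theorem inner_toOp {w : NonnegForm X} (h : w ≤ t) (x y : X) :
    ⟪t.toH y, t.toOp w (t.toH x)⟫_ℂ = w x y := by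
  rw [toOp, ContinuousLinearMap.comp_apply, ContinuousLinearMap.adjoint_inner_right, HMap_toH t h,
    HMap_toH t h, inner_toH]

theorem re_inner_toOp {w : NonnegForm X} (h : w ≤ t) (x : X) :
    (⟪t.toOp w (t.toH x), t.toH x⟫_ℂ).re = w.quad x := by
  refine (inner_re_symm (𝕜 := ℂ) (E := t.H) _ _).trans ?_
  exact congrArg Complex.re (inner_toOp t h x x)

theorem toOp_le_one {w : NonnegForm X} (h : w ≤ t) : t.toOp w ≤ 1 := by
  rw [ContinuousLinearMap.le_iff_forall_re_inner_of_denseRange t.denseRange_toH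
    (.of_nonneg (t.toOp_nonneg w)) (.one _)]
  intro x
  rw [re_inner_toOp t h, one_apply_eq_self, inner_toH]
  exact h x

theorem toOp_le_toOp_iff {v w : NonnegForm X} (hv : v ≤ t) (hw : w ≤ t) :
    t.toOp v ≤ t.toOp w ↔ v ≤ w := by
  rw [ContinuousLinearMap.le_iff_forall_re_inner_of_denseRange t.denseRange_toH
    (.of_nonneg (t.toOp_nonneg v)) (.of_nonneg (t.toOp_nonneg w))]
  simp only [re_inner_toOp t hv, re_inner_toOp t hw]
  rfl

/-- A self-adjoint operator is determined by its quadratic form on the dense image of `X`.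
Compatibility with convex combinations, parallel sums and shorts all reduce to this. -/
theorem toOp_eq {w : NonnegForm X} (hw : w ≤ t) {A : t.H →L[ℂ] t.H} (hA : 0 ≤ A)
    (h : ∀ x, w.quad x = (⟪A (t.toH x), t.toH x⟫_ℂ).re) : t.toOp w = A :=
  ContinuousLinearMap.eq_of_forall_re_inner_of_denseRange t.denseRange_toH
    (.of_nonneg (t.toOp_nonneg w)) (.of_nonneg hA) fun x => by rw [re_inner_toOp t hw, h]

/-- The form on `X` given by a positive operator on `H_t`. -/
noncomputable def ofOp (A : t.H →L[ℂ] t.H) (hA : 0 ≤ A) : NonnegForm X := (PosOp.toForm A hA).comap t.toH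

theorem quad_ofOp (A : t.H →L[ℂ] t.H) (hA : 0 ≤ A) (x : X) :
    (t.ofOp A hA).quad x = (⟪A (t.toH x), t.toH x⟫_ℂ).re :=
  PosOp.quad_toForm A hA _

theorem ofOp_le {A : t.H →L[ℂ] t.H} (hA : 0 ≤ A) (h1 : A ≤ 1) : t.ofOp A hA ≤ t := fun x => by
  rw [quad_ofOp]
  refine ((ContinuousLinearMap.le_iff_forall_re_inner (.of_nonneg hA) (.one _)).1 h1 _).trans ?_
  rw [one_apply_eq_self, inner_toH]
  rfl

theorem toOp_ofOp {A : t.H →L[ℂ] t.H} (hA : 0 ≤ A) (h1 : A ≤ 1) : t.toOp (t.ofOp A hA) = A :=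
  t.toOp_eq (t.ofOp_le hA h1) hA (t.quad_ofOp A hA)

theorem ofOp_toOp {w : NonnegForm X} (h : w ≤ t) : t.ofOp (t.toOp w) (t.toOp_nonneg w) = w :=
  ext_quad fun x => by rw [quad_ofOp, re_inner_toOp t h]

theorem ofOp_le_iff {A : t.H →L[ℂ] t.H} (hA : 0 ≤ A) (h1 : A ≤ 1) {w : NonnegForm X}
    (h : w ≤ t) : t.ofOp A hA ≤ w ↔ A ≤ t.toOp w := by
  rw [← t.toOp_le_toOp_iff (t.ofOp_le hA h1) h, toOp_ofOp t hA h1]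

/-- The interval `[0, t]` of forms is order isomorphic to the interval `[0, 1]` of operators
on `H_t`. -/
noncomputable def opIso : Set.Icc (0 : NonnegForm X) t ≃o Set.Icc (0 : t.H →L[ℂ] t.H) 1 where
  toFun w := ⟨t.toOp w, t.toOp_nonneg w, t.toOp_le_one w.2.2⟩
  invFun A := ⟨t.ofOp A A.2.1, NonnegForm.nonneg _, t.ofOp_le A.2.1 A.2.2⟩
  left_inv w := Subtype.ext (t.ofOp_toOp w.2.2)
  right_inv A := Subtype.ext (t.toOp_ofOp A.2.1 A.2.2)
  map_rel_iff' {v w} := t.toOp_le_toOp_iff v.2.2 w.2.2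

theorem convexCombination_le {u v : NonnegForm X} (hu : u ≤ t) (hv : v ≤ t) {α β : ℝ≥0}
    (h : α + β = 1) : α • u + β • v ≤ t := fun x => by
  rw [quad_add, quad_smul, quad_smul]
  have h' : (α : ℝ) + β = 1 := by exact_mod_cast h
  calc (α : ℝ) * u.quad x + β * v.quad x ≤ α * t.quad x + β * t.quad x :=
        add_le_add (mul_le_mul_of_nonneg_left (hu x) α.2) (mul_le_mul_of_nonneg_left (hv x) β.2)
    _ = t.quad x := by rw [← add_mul, h', one_mul]

theorem toOp_convexCombination {u v : NonnegForm X} (hu : u ≤ t) (hv : v ≤ t) {α β : ℝ≥0}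
    (h : α + β = 1) : t.toOp (α • u + β • v)
      = ((α : ℝ) : ℂ) • t.toOp u + ((β : ℝ) : ℂ) • t.toOp v := by
  have hn := fun (c : ℝ≥0) (w : NonnegForm X) =>
    ContinuousLinearMap.ofReal_smul_nonneg c.2 (t.toOp_nonneg w)
  refine t.toOp_eq (t.convexCombination_le hu hv h) (add_nonneg (hn _ _) (hn _ _)) fun x => ?_
  rw [quad_add, quad_smul, quad_smul, ← re_inner_toOp t hu, ← re_inner_toOp t hv, add_apply,
    smul_apply, smul_apply, inner_add_left, inner_smul_left, inner_smul_left, Complex.conj_ofReal,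
    Complex.conj_ofReal, Complex.add_re, Complex.re_ofReal_mul, Complex.re_ofReal_mul]

theorem toOp_parallelSum {u v : NonnegForm X} (hu : u ≤ t) (hv : v ≤ t) :
    t.toOp (u.parallelSum v)
      = PosOp.parallelSum (t.toOp u) (t.toOp v) (t.toOp_nonneg u) (t.toOp_nonneg v) :=
  t.toOp_eq ((parallelSum_le_left u v).trans hu) (PosOp.parallelSum_nonneg _ _ _ _)
    (PosOp.quad_parallelSum_of_denseRange t.denseRange_toH _ _
      (fun x => (t.re_inner_toOp hu x).symm) fun x => (t.re_inner_toOp hv x).symm)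

theorem toOp_short {u v : NonnegForm X} (hu : u ≤ t) (hv : v ≤ t) :
    t.toOp (short u v)
      = PosOp.short (t.toOp u) (t.toOp v) (t.toOp_nonneg u) (t.toOp_nonneg v) :=
  t.toOp_eq ((short_le u v).trans hv) (PosOp.short_nonneg _ _ _ _)
    (PosOp.quad_short_of_denseRange t.denseRange_toH _ _
      (fun x => (t.re_inner_toOp hu x).symm) fun x => (t.re_inner_toOp hv x).symm)

/-! ### Disjoint parts as projections -/

variable {t}

theorem toOp_self : t.toOp t = 1 :=
  t.toOp_eq le_rfl zero_le_one fun x => by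
    rw [one_apply_eq_self, inner_toH]
    rfl

/-- With `T = t.toOp w`, the form of `T - T²` is a common minorant of `w` and `t - w`, so it is
zero. -/
theorem IsDisjointPart.toOp_mul_self {w : NonnegForm X} (hw : w.IsDisjointPart t) :
    t.toOp w * t.toOp w = t.toOp w := by
  obtain ⟨hwt, hs⟩ := hw
  have h0 := t.toOp_nonneg w
  have h1 := t.toOp_le_one hwt
  have hA : 0 ≤ t.toOp w - t.toOp w * t.toOp w :=
    ContinuousLinearMap.sub_mul_self_nonneg h0 h1
  have hAw := ContinuousLinearMap.sub_mul_self_le_self (.of_nonneg h0)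
  have hA1 := ContinuousLinearMap.sub_mul_self_le_one_sub (.of_nonneg h0)
  have hr := hs (t.ofOp _ hA) ((t.ofOp_le_iff hA (hAw.trans h1) hwt).2 hAw) fun x => by
    rw [quad_sub_form, quad_ofOp, ← re_inner_toOp t hwt]
    have := (ContinuousLinearMap.le_iff_forall_re_inner (.of_nonneg hA)
      ((IsSelfAdjoint.one _).sub (.of_nonneg h0))).1 hA1 (t.toH x)
    rw [sub_apply 1, inner_sub_left, Complex.sub_re, one_apply_eq_self,
      inner_toH] at this
    exact this
  have := t.toOp_ofOp hA (hAw.trans h1)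
  rw [hr, t.toOp_eq t.nonneg le_rfl (by simp)] at this
  exact (sub_eq_zero.1 this.symm).symm

/-- As `t` corresponds to `1`, `D_w t` corresponds to `[T]1` for a projection `T`, which is at most
`T`. -/
theorem IsDisjointPart.isQuasiUnit {w : NonnegForm X} (hw : w.IsDisjointPart t) :
    w.IsQuasiUnit t := by
  refine le_antisymm ?_ (le_short_of_le hw.1 le_rfl)
  rw [← t.toOp_le_toOp_iff (short_le _ _) hw.1, toOp_short t hw.1 le_rfl]
  simp only [toOp_self]
  exact PosOp.short_one_le_of_isIdempotent _ _ hw.toOp_mul_self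

theorem tfae_isQuasiUnit {w : NonnegForm X} (hwt : w ≤ t) :
    List.TFAE [w.IsQuasiUnit t, w ∈ (Set.Icc (0 : NonnegForm X) t).extremePoints ℝ≥0,
      w.IsDisjointPart t] := by
  tfae_have 1 → 2 := fun h => h.mem_extremePoints hwt
  tfae_have 2 → 3 := isDisjointPart_of_mem_extremePoints
  tfae_have 3 → 1 := fun h => h.isQuasiUnit
  tfae_finish

/-! ### Existence of the infimum of two forms -/

/-- The hypothesis says that `D_u v ≤ u`, so `D_u v` is a common lower bound of `u` and `v`, hence
below `D_v u`. -/
theorem short_le_short_of_forall_le {u v : NonnegForm X}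
    (h : ∀ n : ℕ, parallelSum v (n • u) ≤ u) : short u v ≤ short v u := by
  refine le_short_of_le (fun x => ?_) (short_le u v)
  rw [quad_short]
  exact ciSup_le fun n => h n x

theorem short_le_or_le_of_isGLB {u v s : NonnegForm X} (hs : IsGLB {u, v} s) :
    short u v ≤ short v u ∨ short v u ≤ short u v := by
  -- With this choice both forms lie in `[0, t]` and their operators sum to `1`.
  let t := u + v
  have hu : u ≤ t := fun x => le_add_of_nonneg_right (v.quad_nonneg x)
  have hv : v ≤ t := fun x => le_add_of_nonneg_left (u.quad_nonneg x)
  have hsu : s ≤ u := hs.1 (by simp)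
  have hsv : s ≤ v := hs.1 (by simp)
  have hst := hsu.trans hu
  have hsum : t.toOp u + t.toOp v = 1 := by
    rw [← t.toOp_self]
    refine (t.toOp_eq le_rfl (add_nonneg (t.toOp_nonneg _) (t.toOp_nonneg _)) fun x => ?_).symm
    rw [add_apply, inner_add_left, Complex.add_re, re_inner_toOp t hu, re_inner_toOp t hv]
    rfl
  -- `n • w` need not lie below `t`, so the multiple is taken on the operator side.
  have hnsmul : ∀ {w r : NonnegForm X} (n : ℕ), w ≤ t → r ≤ t → r ≤ n • w →
      t.toOp r ≤ n • t.toOp w := fun {w r} n hw hr h => by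
    rw [ContinuousLinearMap.le_iff_forall_re_inner_of_denseRange t.denseRange_toH
      (.of_nonneg (t.toOp_nonneg r)) (.of_nonneg (nsmul_nonneg (t.toOp_nonneg w) n))]
    intro x
    rw [PosOp.re_inner_nsmul, re_inner_toOp t hr, re_inner_toOp t hw, ← quad_nsmul]
    exact h x
  have aux : ∀ {u v : NonnegForm X}, u ≤ t → v ≤ t →
      (∀ (S : t.H →L[ℂ] t.H) (n : ℕ), 0 ≤ S → S ≤ t.toOp v → S ≤ n • t.toOp u → S ≤ t.toOp u) →
      short u v ≤ short v u := fun {u v} hu hv h => by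
    refine short_le_short_of_forall_le fun n => ?_
    have h1 := parallelSum_le_left v (n • u)
    have h2 := h1.trans hv
    exact (t.toOp_le_toOp_iff h2 hu).1 (h _ n (t.toOp_nonneg _) ((t.toOp_le_toOp_iff h2 hv).2 h1)
      (hnsmul n hu h2 (parallelSum_le_right _ _)))
  refine (ContinuousLinearMap.le_or_le_of_exists_inf (t.toOp_nonneg u) (t.toOp_nonneg v) hsum
    ((t.toOp_le_toOp_iff hst hu).2 hsu) ((t.toOp_le_toOp_iff hst hv).2 hsv) ?_).imp
    (aux hu hv) (aux hv hu)
  -- The form of `D` is a common lower bound of `u` and `v`, hence below `s`.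
  intro D hD hDu hDv
  have hD1 := hDu.trans (t.toOp_le_one hu)
  refine (t.ofOp_le_iff hD hD1 hst).1 (hs.2 ?_)
  rintro _ (rfl | rfl)
  · exact (t.ofOp_le_iff hD hD1 hu).2 hDu
  · exact (t.ofOp_le_iff hD hD1 hv).2 hDv

theorem exists_isGLB_iff (u v : NonnegForm X) : (∃ s : NonnegForm X, IsGLB {u, v} s) ↔
    (short u v ≤ short v u ∨ short v u ≤ short u v) := by
  refine ⟨fun ⟨_, hs⟩ => short_le_or_le_of_isGLB hs, ?_⟩
  rintro (h | h)
  · exact exists_isGLB_of_short_le h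
  · rw [Set.pair_comm]
    exact exists_isGLB_of_short_le h

end NonnegForm

theorem mainTheorem3 {X : Type*} [AddCommGroup X] [Module ℂ X] (t : NonnegForm X) :
    (∃ Φ : Set.Icc (0 : NonnegForm X) t ≃o Set.Icc (0 : t.H →L[ℂ] t.H) 1,
      (∀ (w : Set.Icc (0 : NonnegForm X) t) (x y : X),
        ⟪t.toH y, (Φ w : t.H →L[ℂ] t.H) (t.toH x)⟫_ℂ = (w : NonnegForm X) x y) ∧
      (∀ (u v : Set.Icc (0 : NonnegForm X) t) (α β : ℝ≥0), α + β = 1 →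
        ∃ h : α • (u : NonnegForm X) + β • (v : NonnegForm X) ∈ Set.Icc (0 : NonnegForm X) t,
          (Φ ⟨_, h⟩ : t.H →L[ℂ] t.H)
            = ((α : ℝ) : ℂ) • (Φ u : t.H →L[ℂ] t.H) + ((β : ℝ) : ℂ) • (Φ v : t.H →L[ℂ] t.H)) ∧
      (∀ u v : Set.Icc (0 : NonnegForm X) t,
        ∃ h : NonnegForm.parallelSum (u : NonnegForm X) v ∈ Set.Icc (0 : NonnegForm X) t,
          (Φ ⟨_, h⟩ : t.H →L[ℂ] t.H)
            = PosOp.parallelSum (Φ u : t.H →L[ℂ] t.H) (Φ v) (Φ u).2.1 (Φ v).2.1) ∧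
      (∀ u w : Set.Icc (0 : NonnegForm X) t,
        ∃ h : NonnegForm.short (u : NonnegForm X) w ∈ Set.Icc (0 : NonnegForm X) t,
          (Φ ⟨_, h⟩ : t.H →L[ℂ] t.H)
            = PosOp.short (Φ u : t.H →L[ℂ] t.H) (Φ w) (Φ u).2.1 (Φ w).2.1)) ∧
    (∀ w ∈ Set.Icc (0 : NonnegForm X) t,
      List.TFAE [w.IsQuasiUnit t,
        w ∈ (Set.Icc (0 : NonnegForm X) t).extremePoints ℝ≥0,
        w.IsDisjointPart t]) ∧
    (∀ u v : NonnegForm X,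
      (∃ s : NonnegForm X, IsGLB {u, v} s) ↔
        (NonnegForm.short u v ≤ NonnegForm.short v u ∨
          NonnegForm.short v u ≤ NonnegForm.short u v)) := by
  refine ⟨⟨t.opIso, fun w => t.inner_toOp w.2.2, fun u v α β h => ?_, fun u v => ?_, fun u w => ?_⟩,
    fun w hw => NonnegForm.tfae_isQuasiUnit hw.2, NonnegForm.exists_isGLB_iff⟩
  · exact ⟨⟨NonnegForm.nonneg _, t.convexCombination_le u.2.2 v.2.2 h⟩,
      t.toOp_convexCombination u.2.2 v.2.2 h⟩
  · exact ⟨⟨NonnegForm.nonneg _, (NonnegForm.parallelSum_le_left _ _).trans u.2.2⟩,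
      t.toOp_parallelSum u.2.2 v.2.2⟩
  · exact ⟨⟨NonnegForm.nonneg _, (NonnegForm.short_le _ _).trans w.2.2⟩,
      t.toOp_short u.2.2 w.2.2⟩
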